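/- Label each nearest-neighbour edge of the square lattice $\mathbb{Z}^2$ with $0$ or $1$. A labelling has the cocycle property if, for every unit square, the sum of the labels along the two-step route from its south-west to its north-east corner is the same for both routes. Let $\mu$ be a probability measure on labellings (with the product $\sigma$-algebra) that is concentrated on labellings with the cocycle property and is stationary and ergodic with respect to the group of all translations of $\mathbb{Z}^2$. Let $h$ and $v$ be the expected labels of a horizontal and of a vertical edge, respectively, and assume $0<h<1$ and $0<v<1$. The cluster of a vertex $z$ is the set of all vertices that can be reached from $z$ through edges labelled $0$; the edges of a cluster $C$ are the $0$-labelled edges with both endpoints in $C$. Lemma 3.4. With $\mu$-probability one, every infinite cluster $C$ contains a strictly northwest–southeast directed bi-infinite path, that is, there is a sequence $(p_k)_{k\in\mathbb{Z}}$ in $\mathbb{Z}^2$ such that every step $p_{k+1}-p_k$ is $(-1,0)$ or $(0,1)$, the first coordinate of $p_k$ tends to $\mp\infty$ and the second to $\pm\infty$ as $k\to\pm\infty$, and all edges $\{p_k,p_{k+1}\}$ are edges of $C$. More precisely, the left boundary of $C$ forms such a path: for every $n\in\mathbb{Z}$ there is a leftmost vertical edge $e_n$ of $C$ between the lines $y=n$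 and $y=n+1$, and the path can be chosen so that the set of its edges is exactly the set consisting of the edges $e_n$, $n\in\mathbb{Z}$, and the horizontal lattice edges between the upper endpoint of $e_n$ and the lower endpoint of $e_{n+1}$, $n\in\mathbb{Z}$. -/

import Mathlib

open MeasureTheory Filter

namespace CocyclePercolation

/-- A nearest-neighbour edge of the square lattice: `horizontal x y` joins `(x, y)` to `(x + 1, y)`
and `vertical x y` joins `(x, y)` to `(x, y + 1)`. -/
inductive Edge : Type
  | horizontal (x y : ℤ) : Edge
  | vertical (x y : ℤ) : Edge

namespace Edge

/-- The left (for horizontal edges) or lower (for vertical edges) endpoint. -/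
def src : Edge → ℤ × ℤ
  | horizontal x y => (x, y)
  | vertical x y => (x, y)

/-- The right (for horizontal edges) or upper (for vertical edges) endpoint. -/
def tgt : Edge → ℤ × ℤ
  | horizontal x y => (x + 1, y)
  | vertical x y => (x, y + 1)

/-- The edge translated by the vector `v`. -/
def translate (v : ℤ × ℤ) : Edge → Edge
  | horizontal x y => horizontal (x + v.1) (y + v.2)
  | vertical x y => vertical (x + v.1) (y + v.2)

end Edge

/-- A labelling of the edges of the square lattice by `0` and `1`. -/
def Configuration : Type := Edge → Fin 2

/-- The product sigma-algebra. -/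
instance : MeasurableSpace Configuration := MeasurableSpace.pi (X := fun _ : Edge => Fin 2)

/-- The group of all translations of the lattice acts on labellings. -/
instance : AddAction (ℤ × ℤ) Configuration where
  vadd v ω := fun e => ω (e.translate (-v))
  zero_vadd ω := by
    funext e
    change ω (e.translate (-0)) = ω e
    cases e <;> simp [Edge.translate]
  add_vadd v w ω := by
    funext e
    change ω (e.translate (-(v + w))) = ω ((e.translate (-v)).translate (-w))
    cases e <;> simp [Edge.translate, add_comm, ← add_assoc]

/-- The cocycle property: around every unit square, the two routes with two steps from the
south-west corner to the north-east corner show the same number of labels `1`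
(and hence, each route having two edges, the same number of labels `0`). -/
def IsCocycle (ω : Configuration) : Prop :=
  ∀ x y : ℤ,
    (ω (.horizontal x y) : ℕ) + (ω (.vertical (x + 1) y) : ℕ) =
      (ω (.vertical x y) : ℕ) + (ω (.horizontal x (y + 1)) : ℕ)

/-- A stationary, ergodic cocycle measure: a probability measure on labellings which is concentrated
on labellings with the cocycle property, and which is invariant and ergodic with respect to the
group of all translations of the lattice. -/
structure IsStationaryErgodicCocycleMeasure (μ : Measure Configuration) : Prop where
  isProbabilityMeasure : IsProbabilityMeasure μ
  ae_isCocycle : ∀ᵐ ω ∂μ, IsCocycle ω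
  ergodic : ErgodicVAdd (ℤ × ℤ) Configuration μ

/-- The expected label of the edge `e`. -/
noncomputable def meanLabel (μ : Measure Configuration) (e : Edge) : ℝ :=
  ∫ ω, ((ω e : ℕ) : ℝ) ∂μ

/-- The graph on the vertices of the lattice formed by the edges with label `0`. -/
def zeroGraph (ω : Configuration) : SimpleGraph (ℤ × ℤ) :=
  SimpleGraph.fromRel fun u w => ∃ e : Edge, ω e = 0 ∧ e.src = u ∧ e.tgt = w

/-- The cluster of `z`: all vertices that can be reached from `z` by travelling over edges with
label `0` only. -/
def cluster (ω : Configuration) (z : ℤ × ℤ) : Set (ℤ × ℤ) :=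
  {w | (zeroGraph ω).Reachable z w}

/-- The edges of a cluster `C`: those with label `0` and with both endpoints in `C`. -/
def clusterEdges (ω : Configuration) (C : Set (ℤ × ℤ)) : Set Edge :=
  {e | ω e = 0 ∧ e.src ∈ C ∧ e.tgt ∈ C}

/-- `vertical x n` is the leftmost vertical edge of `C` between the levels `n` and `n + 1`. -/
def IsLeftmostVertical (ω : Configuration) (C : Set (ℤ × ℤ)) (n x : ℤ) : Prop :=
  IsLeast {t : ℤ | Edge.vertical t n ∈ clusterEdges ω C} x

/-- The left boundary of `C`: the leftmost vertical edges `e_n` of all levels `n`, together with,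
for all `n`, the horizontal lattice edges between the upper endpoint of `e_n` and the lower endpoint
of `e_{n+1}` (none, if these endpoints agree). -/
def leftBoundary (ω : Configuration) (C : Set (ℤ × ℤ)) : Set Edge :=
  {e | ∃ n x : ℤ, IsLeftmostVertical ω C n x ∧ e = .vertical x n} ∪
  {e | ∃ n x x' t : ℤ, IsLeftmostVertical ω C n x ∧ IsLeftmostVertical ω C (n + 1) x' ∧
    min x x' ≤ t ∧ t < max x x' ∧ e = .horizontal t (n + 1)}

/-- A strictly northwest-southeast directed bi-infinite path: each step leads to the neighbour in
the west or to the neighbour in the north, and the path goes off to infinity in the north and in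
the west as the parameter tends to `∞`, in the south and in the east as it tends to `-∞`. -/
structure IsNWSEPath (p : ℤ → ℤ × ℤ) : Prop where
  step : ∀ k : ℤ, p (k + 1) = p k + (-1, 0) ∨ p (k + 1) = p k + (0, 1)
  west : Tendsto (fun k => (p k).1) atTop atBot
  north : Tendsto (fun k => (p k).2) atTop atTop
  east : Tendsto (fun k => (p k).1) atBot atTop
  south : Tendsto (fun k => (p k).2) atBot atBot

/-- The edges that a path runs through. -/
def pathEdges (p : ℤ → ℤ × ℤ) : Set Edge :=
  {e | ∃ k : ℤ, s(e.src, e.tgt) = s(p k, p (k + 1))}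

end CocyclePercolation

open CocyclePercolation

namespace CocyclePercolation

/-! ### Summation of two-sided integer sequences. -/

section IntegerSequences

/-! By the cocycle property the labels are the increments of a height `f` that is nondecreasing in
both coordinates and constant on clusters. If every row has ones arbitrarily far on both sides, the
sites of height `c` in row `y` form a nonempty finite interval, joined by 0-edges. Its left end `a
y` moves weakly west as `y` grows, because going up cannot lower `f`.

Suppose a cluster of height `c` contains `(a y, y)` but the edge above this site is labelled 1. By
monotonicity the cluster has no 0-edge up from row `y`, so `(a y, y)` is its top left vertex. Mass
transport (`ae_noExtremalVertex`) rules this out for infinite clusters; bottom left vertices are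
treated alike. An infinite cluster therefore meets every row and has its leftmost vertical edges at
the `a y`. Monotonicity of `f` puts the connecting horizontal edges on the same level, and
`Antitone.exists_staircase` parametrizes the result.

Ones on both sides of every row and column come from Poincaré recurrence, once no row or column
vanishes. A vanishing one would force all parallel ones to vanish (`OnesBothSides.forall_eq_zero`),
against ergodicity and the positive means. The ones in the columns make `a` unbounded in both
directions. -/

theorem exists_antidifference (g : ℤ → ℤ) : ∃ F : ℤ → ℤ, F 0 = 0 ∧ ∀ n, F (n + 1) = F n + g n := by
  refine ⟨fun n => ∑ i ∈ Finset.Ico 0 n, g i - ∑ i ∈ Finset.Ico n 0, g i, by simp, fun n => ?_⟩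
  rcases le_or_gt 0 n with h | h
  · have e : Finset.Ico 0 (n + 1) = insert n (Finset.Ico 0 n) := by ext; simp; omega
    have e1 : Finset.Ico n 0 = ∅ := by ext; simp; omega
    have e2 : Finset.Ico (n + 1) 0 = ∅ := by ext; simp; omega
    simp [e, e1, e2, add_comm]
  · have e : Finset.Ico n 0 = insert n (Finset.Ico (n + 1) 0) := by ext; simp; omega
    have e1 : Finset.Ico 0 n = ∅ := by ext; simp; omega
    have e2 : Finset.Ico 0 (n + 1) = ∅ := by ext; simp; omega
    simp [e, e1, e2]

/-- A two-sided 0-1 sequence that shows the value `1` arbitrarily far in both directions. -/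
def OnesBothSides (s : ℤ → Fin 2) : Prop :=
  ∀ N : ℤ, (∃ n, N ≤ n ∧ s n ≠ 0) ∧ ∃ n, n ≤ N ∧ s n ≠ 0

theorem fin_two_val_eq_one {a : Fin 2} (h : a ≠ 0) : (a : ℕ) = 1 := by
  fin_cases a <;> simp_all

theorem OnesBothSides.unbounded_above {s : ℤ → Fin 2} (hs : OnesBothSides s) {F : ℤ → ℤ}
    (hF : ∀ n, F (n + 1) = F n + ((s n : ℕ) : ℤ)) (c : ℤ) : ∃ n, c ≤ F n := by
  have hm : Monotone F := monotone_int_of_le_succ fun n => by rw [hF]; omega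
  have key : ∀ k : ℕ, ∃ n, F 0 + k ≤ F n := by
    intro k
    induction k with
    | zero => exact ⟨0, by simp⟩
    | succ k ih =>
      obtain ⟨n, hn⟩ := ih
      obtain ⟨m, hm1, hm2⟩ := (hs n).1
      have h1 := hm hm1
      have h2 := hF m
      rw [fin_two_val_eq_one hm2] at h2
      exact ⟨m + 1, by push_cast at *; omega⟩
  obtain ⟨n, hn⟩ := key (c - F 0).toNat
  exact ⟨n, by omega⟩

theorem OnesBothSides.unbounded_below {s : ℤ → Fin 2} (hs : OnesBothSides s) {F : ℤ → ℤ}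
    (hF : ∀ n, F (n + 1) = F n + ((s n : ℕ) : ℤ)) (c : ℤ) : ∃ n, F n < c := by
  have hm : Monotone F := monotone_int_of_le_succ fun n => by rw [hF]; omega
  have key : ∀ k : ℕ, ∃ n, F n ≤ F 0 - k := by
    intro k
    induction k with
    | zero => exact ⟨0, by simp⟩
    | succ k ih =>
      obtain ⟨n, hn⟩ := ih
      obtain ⟨m, hm1, hm2⟩ := (hs (n - 1)).2
      have h1 : F (m + 1) ≤ F n := hm (by omega)
      have h2 := hF m
      rw [fin_two_val_eq_one hm2] at h2
      exact ⟨m, by push_cast at *; omega⟩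
  obtain ⟨n, hn⟩ := key (F 0 - c + 1).toNat
  exact ⟨n, by omega⟩

end IntegerSequences

/-! ### Clusters and their extremal vertices. -/

section Clusters

variable {ω : Configuration}

theorem zeroGraph_adj_iff {u w : ℤ × ℤ} : (zeroGraph ω).Adj u w ↔
    ∃ e : Edge, ω e = 0 ∧ ((e.src = u ∧ e.tgt = w) ∨ (e.src = w ∧ e.tgt = u)) := by
  rw [zeroGraph, SimpleGraph.fromRel_adj]
  constructor
  · rintro ⟨-, ⟨e, h0, h⟩ | ⟨e, h0, h⟩⟩
    exacts [⟨e, h0, Or.inl h⟩, ⟨e, h0, Or.inr h⟩]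
  · rintro ⟨e, h0, h⟩
    refine ⟨?_, ?_⟩
    · rintro rfl
      have : e.src = e.tgt := by rcases h with h | h <;> rw [h.1, h.2]
      cases e <;> simp [Edge.src, Edge.tgt] at this
    · rcases h with h | h
      exacts [Or.inl ⟨e, h0, h⟩, Or.inr ⟨e, h0, h⟩]

theorem adj_of_label_eq_zero {e : Edge} (h : ω e = 0) : (zeroGraph ω).Adj e.src e.tgt :=
  zeroGraph_adj_iff.2 ⟨e, h, Or.inl ⟨rfl, rfl⟩⟩

theorem mem_cluster_of_adj {z u w : ℤ × ℤ} (hu : u ∈ cluster ω z) (h : (zeroGraph ω).Adj u w) :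
    w ∈ cluster ω z :=
  SimpleGraph.Reachable.trans hu h.reachable

theorem cluster_eq_of_mem {z u : ℤ × ℤ} (hu : u ∈ cluster ω z) : cluster ω u = cluster ω z :=
  Set.ext fun _ => ⟨fun h => SimpleGraph.Reachable.trans hu h,
    fun h => (SimpleGraph.Reachable.symm hu).trans h⟩

theorem cluster_subset_of_adj_closed {z : ℤ × ℤ} {S : Set (ℤ × ℤ)} (hz : z ∈ S)
    (h : ∀ u w, u ∈ cluster ω z → u ∈ S → (zeroGraph ω).Adj u w → w ∈ S) : cluster ω z ⊆ S := by
  intro w hw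
  have hw' := (SimpleGraph.reachable_iff_reflTransGen _ _).1 hw
  induction hw' with
  | refl => exact hz
  | tail hb hc ih =>
    have hb' := (SimpleGraph.reachable_iff_reflTransGen _ _).2 hb
    exact h _ _ hb' (ih hb') hc

/-- The vertex `w` lies above, or on the same level and not to the right of, the vertex `u`. -/
def TopLeft (w u : ℤ × ℤ) : Prop := u.2 < w.2 ∨ u.2 = w.2 ∧ w.1 ≤ u.1

/-- The vertex `w` lies below, or on the same level and not to the right of, the vertex `u`. -/
def BottomLeft (w u : ℤ × ℤ) : Prop := w.2 < u.2 ∨ u.2 = w.2 ∧ w.1 ≤ u.1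

/-- No infinite cluster has a vertex which is extremal for the relation `r`. -/
def NoExtremalVertex (r : ℤ × ℤ → ℤ × ℤ → Prop) (ω : Configuration) : Prop :=
  ∀ w, (∀ t ∈ cluster ω w, r w t) → (cluster ω w).Finite

end Clusters

/-! ### The height function of a cocycle. -/

section Height

variable {ω : Configuration}

/-- A function on the vertices whose increments are the labels. -/
def IsHeight (ω : Configuration) (f : ℤ → ℤ → ℤ) : Prop :=
  ∀ x y, f (x + 1) y = f x y + ((ω (.horizontal x y) : ℕ) : ℤ) ∧
    f x (y + 1) = f x y + ((ω (.vertical x y) : ℕ) : ℤ)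

/-- Sum the labels along the row `y = 0` and then along columns; the cocycle relation carries the
horizontal increments from row to row. -/
theorem IsCocycle.exists_isHeight (h : IsCocycle ω) : ∃ f, IsHeight ω f := by
  obtain ⟨H, -, hH⟩ := exists_antidifference fun x => ((ω (.horizontal x 0) : ℕ) : ℤ)
  choose V hV0 hV using fun x => exists_antidifference fun y => ((ω (.vertical x y) : ℕ) : ℤ)
  refine ⟨fun x y => H x + V x y, fun x y => ⟨?_, by simp [hV, add_assoc]⟩⟩
  induction y using Int.induction_on with
  | zero => simp [hV0, hH]
  | succ y ih =>
    have := h x y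
    simp only [hV] at *
    omega
  | pred y ih =>
    have := h x (-y - 1)
    have h1 := hV x (-y - 1)
    have h2 := hV (x + 1) (-y - 1)
    simp only [sub_add_cancel] at *
    omega

namespace IsHeight

variable {f : ℤ → ℤ → ℤ} (hf : IsHeight ω f)
include hf

theorem monotone_fst (y : ℤ) : Monotone fun x => f x y :=
  monotone_int_of_le_succ fun x => by rw [(hf x y).1]; omega

theorem monotone_snd (x : ℤ) : Monotone (f x) :=
  monotone_int_of_le_succ fun y => by rw [(hf x y).2]; omega

theorem label_horizontal {x y : ℤ} (h : f (x + 1) y = f x y) : ω (.horizontal x y) = 0 := by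
  have := (hf x y).1
  exact Fin.ext (by simp; omega)

theorem label_vertical {x y : ℤ} (h : f x (y + 1) = f x y) : ω (.vertical x y) = 0 := by
  have := (hf x y).2
  exact Fin.ext (by simp; omega)

theorem eq_of_label_eq_zero {e : Edge} (h : ω e = 0) : f e.tgt.1 e.tgt.2 = f e.src.1 e.src.2 := by
  cases e with
  | horizontal x y => simpa [h, Edge.src, Edge.tgt] using (hf x y).1
  | vertical x y => simpa [h, Edge.src, Edge.tgt] using (hf x y).2

theorem eq_of_adj {u w : ℤ × ℤ} (h : (zeroGraph ω).Adj u w) : f w.1 w.2 = f u.1 u.2 := by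
  obtain ⟨e, h0, ⟨rfl, rfl⟩ | ⟨rfl, rfl⟩⟩ := zeroGraph_adj_iff.1 h
  exacts [hf.eq_of_label_eq_zero h0, (hf.eq_of_label_eq_zero h0).symm]

theorem eq_of_mem_cluster {z w : ℤ × ℤ} (h : w ∈ cluster ω z) : f w.1 w.2 = f z.1 z.2 :=
  cluster_subset_of_adj_closed (S := {w | f w.1 w.2 = f z.1 z.2}) rfl
    (fun _ _ _ hu huw => (hf.eq_of_adj huw).trans hu) h

/-- Monotonicity makes `f` constant between the two sites, so all edges between them are labelled 0.
Thus a cluster meeting a row contains every site of its height there. -/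
theorem mem_cluster_of_level {z : ℤ × ℤ} {x x' y : ℤ} (h : (x, y) ∈ cluster ω z)
    (h' : f x y = f x' y) : (x', y) ∈ cluster ω z := by
  have key : ∀ a b : ℤ, a ≤ b → f a y = f b y → (zeroGraph ω).Reachable (a, y) (b, y) := by
    intro a b hab
    induction b, hab using Int.leInduction with
    | base => exact fun _ => .refl _
    | succ b hb ih =>
      intro hab
      have h1 : f a y ≤ f b y := hf.monotone_fst y hb
      have h2 : f b y ≤ f (b + 1) y := hf.monotone_fst y (by omega)
      exact (ih (by omega)).trans
        (adj_of_label_eq_zero (hf.label_horizontal (x := b) (y := y) (by omega))).reachable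
  rcases le_total x x' with hx | hx
  · exact SimpleGraph.Reachable.trans h (key _ _ hx h')
  · exact SimpleGraph.Reachable.trans h (key _ _ hx h'.symm).symm

end IsHeight

end Height

/-! ### Staircases as directed paths. -/

section Staircase

/-- The edges of the staircase which runs vertically along `x = a n` between the levels `n` and
`n + 1` and horizontally otherwise. -/
def staircaseEdges (a : ℤ → ℤ) : Set Edge :=
  {e | ∃ n, e = .vertical (a n) n} ∪
  {e | ∃ n t, a (n + 1) ≤ t ∧ t < a n ∧ e = .horizontal t (n + 1)}

/-- Each step west or north raises `y - x` by one, so `k = y - x` serves as the time. In row `y` the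
staircase covers `a y ≤ x ≤ a (y - 1)`, and it has to cross the diagonal `y - x = k`. -/
theorem Antitone.exists_level {a : ℤ → ℤ} (ha : Antitone a) (k : ℤ) :
    ∃ y, a y ≤ y - k ∧ y - k ≤ a (y - 1) := by
  obtain ⟨y, hy, hmin⟩ := Int.exists_least_of_bdd (P := fun y => a y ≤ y - k)
    ⟨min 0 (a 0 + k), fun z hz => by
      by_contra! hlt
      have : a 0 ≤ a z := ha (by omega)
      omega⟩
    ⟨max 0 (a 0 + k), by
      have : a (max 0 (a 0 + k)) ≤ a 0 := ha (by omega)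
      omega⟩
  refine ⟨y, hy, ?_⟩
  by_contra! hlt
  have := hmin (y - 1) (by omega)
  omega

theorem Antitone.level_unique {a : ℤ → ℤ} (ha : Antitone a) {k y y' : ℤ}
    (h : a y ≤ y - k ∧ y - k ≤ a (y - 1)) (h' : a y' ≤ y' - k ∧ y' - k ≤ a (y' - 1)) :
    y = y' := by
  rcases lt_trichotomy y y' with hlt | heq | hlt
  · have : a (y' - 1) ≤ a y := ha (by omega)
    omega
  · exact heq
  · have : a (y - 1) ≤ a y' := ha (by omega)
    omega

theorem Antitone.exists_staircase {a : ℤ → ℤ} (ha : Antitone a) (hbelow : ∀ b, ∃ n, a n ≤ b)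
    (habove : ∀ b, ∃ n, b ≤ a n) :
    ∃ p, IsNWSEPath p ∧ pathEdges p = staircaseEdges a := by
  choose Y hY using Antitone.exists_level ha
  have hYeq : ∀ {k y}, a y ≤ y - k → y - k ≤ a (y - 1) → Y k = y :=
    fun h1 h2 => Antitone.level_unique ha (hY _) ⟨h1, h2⟩
  -- The path reaches the lower end `(a n, n)` of a vertical edge at time `n - a n`.
  have hlow : ∀ n, Y (n - a n) = n := fun n =>
    hYeq (by omega) (by have : a n ≤ a (n - 1) := ha (by omega); omega)
  -- The path goes west until it reaches `x = a y`, and then north.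
  have hstep : ∀ k, (Y (k + 1) = Y k ∧ a (Y k) < Y k - k) ∨
      (Y (k + 1) = Y k + 1 ∧ a (Y k) = Y k - k) := by
    intro k
    have h := hY k
    rcases h.1.lt_or_eq with hlt | heq
    · exact Or.inl ⟨hYeq (by omega) (by omega), hlt⟩
    · refine Or.inr ⟨hYeq ?_ ?_, heq⟩
      · have : a (Y k + 1) ≤ a (Y k) := ha (by omega)
        omega
      · rw [add_sub_cancel_right]
        omega
  have hmono : Monotone Y := monotone_int_of_le_succ fun k => by
    rcases hstep k with h | h <;> omega
  have hanti : Antitone fun k => Y k - k := antitone_int_of_succ_le fun k => by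
    rcases hstep k with h | h <;> omega
  refine ⟨fun k => (Y k - k, Y k), ⟨fun k => ?_, ?_, ?_, ?_, ?_⟩, ?_⟩
  · rcases hstep k with h | h
    · left; ext <;> simp [h.1]; omega
    · right; ext <;> simp [h.1]
  · refine tendsto_atTop_atBot_of_antitone hanti fun b => ?_
    obtain ⟨n, hn⟩ := hbelow b
    exact ⟨n - a n, by rw [hlow]; omega⟩
  · exact tendsto_atTop_atTop_of_monotone hmono fun b => ⟨b - a b, by rw [hlow]⟩
  · refine tendsto_atBot_atTop_of_antitone hanti fun b => ?_
    obtain ⟨n, hn⟩ := habove b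
    exact ⟨n - a n, by rw [hlow]; omega⟩
  · exact tendsto_atBot_atBot_of_monotone hmono fun b => ⟨b - a b, by rw [hlow]⟩
  · ext e
    constructor
    · rintro ⟨k, hk⟩
      have h := hY k
      rcases hstep k with ⟨h1, h2⟩ | ⟨h1, h2⟩
      · right
        refine ⟨Y k - 1, Y k - k - 1, by rw [sub_add_cancel]; omega, by omega, ?_⟩
        cases e <;> simp [Edge.src, Edge.tgt, h1] at hk ⊢ <;> omega
      · left
        refine ⟨Y k, ?_⟩
        cases e <;> simp [Edge.src, Edge.tgt, h1] at hk ⊢ <;> omega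
    · rintro (⟨n, rfl⟩ | ⟨n, t, h1, h2, rfl⟩)
      · refine ⟨n - a n, ?_⟩
        have : Y (n - a n + 1) = n + 1 := hYeq
          (by have : a (n + 1) ≤ a n := ha (by omega); omega) (by rw [add_sub_cancel_right]; omega)
        simp [Edge.src, Edge.tgt, this, hlow]
      -- The path traverses this edge westward, starting from its right end `(t + 1, n + 1)`.
      · refine ⟨n - t, ?_⟩
        have e1 : Y (n - t) = n + 1 := hYeq (by omega) (by rw [add_sub_cancel_right]; omega)
        have e2 : Y (n - t + 1) = n + 1 := hYeq (by omega) (by rw [add_sub_cancel_right]; omega)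
        simp only [Edge.src, Edge.tgt, e1, e2, Sym2.eq_iff, Prod.mk.injEq, and_true]
        exact Or.inr (by omega)

end Staircase

/-! ### The left boundary of an infinite cluster. -/

section LeftBoundary

variable {ω : Configuration} {f : ℤ → ℤ → ℤ} {a : ℤ → ℤ} {z : ℤ × ℤ}

/-- The height is unbounded both ways along a row and rises by at most one per step, so the first
site of height at least `c` has height exactly `c`. -/
theorem IsHeight.exists_leftmost (hf : IsHeight ω f)
    (hrow : ∀ y, OnesBothSides fun x => ω (.horizontal x y)) (c y : ℤ) :
    ∃ x, f x y = c ∧ ∀ t, c ≤ f t y → x ≤ t := by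
  obtain ⟨b, hb⟩ := (hrow y).unbounded_below (F := fun x => f x y) (fun x => (hf x y).1) c
  obtain ⟨x, hx, hmin⟩ := Int.exists_least_of_bdd (P := fun x => c ≤ f x y)
    ⟨b, fun t ht => by
      by_contra! hlt
      have : f t y ≤ f b y := hf.monotone_fst y hlt.le
      omega⟩
    ((hrow y).unbounded_above (F := fun x => f x y) (fun x => (hf x y).1) c)
  refine ⟨x, le_antisymm ?_ hx, hmin⟩
  by_contra! hlt
  have h1 := (hf (x - 1) y).1
  rw [sub_add_cancel] at h1
  have := hmin (x - 1) (by omega)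
  omega

theorem IsHeight.antitone_leftmost {c : ℤ} (hf : IsHeight ω f)
    (ha : ∀ y, f (a y) y = c ∧ ∀ t, c ≤ f t y → a y ≤ t) : Antitone a :=
  antitone_int_of_succ_le fun y => (ha (y + 1)).2 _ <| by
    rw [← (ha y).1]
    exact hf.monotone_snd _ (by omega)

/-- Otherwise row `y + 1` is higher than the cluster from `a y` eastward, the cluster cannot climb
out of row `y`, and `(a y, y)` is its top left vertex. -/
theorem IsHeight.level_above (hf : IsHeight ω f)
    (ha : ∀ y, f (a y) y = f z.1 z.2 ∧ ∀ t, f z.1 z.2 ≤ f t y → a y ≤ t)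
    (hz : (cluster ω z).Infinite) (htop : NoExtremalVertex TopLeft ω)
    {y : ℤ} (hy : (a y, y) ∈ cluster ω z) : f (a y) (y + 1) = f z.1 z.2 := by
  by_contra hne
  have hgt : f z.1 z.2 < f (a y) (y + 1) := by
    have : f (a y) y ≤ f (a y) (y + 1) := hf.monotone_snd _ (by omega)
    rw [(ha y).1] at this
    omega
  have hsub : cluster ω (a y, y) ⊆ {w | w.2 ≤ y} := by
    refine cluster_subset_of_adj_closed (by simp) fun u w hu huy huw => ?_
    rw [cluster_eq_of_mem hy] at hu
    have hfu := hf.eq_of_mem_cluster hu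
    have hfw := hf.eq_of_mem_cluster (mem_cluster_of_adj hu huw)
    obtain ⟨e, -, ⟨rfl, rfl⟩ | ⟨rfl, rfl⟩⟩ := zeroGraph_adj_iff.1 huw <;>
      rcases e with ⟨s, t⟩ | ⟨s, t⟩ <;>
      simp only [Edge.src, Edge.tgt, Set.mem_ofPred_eq] at *
    · exact huy
    · by_contra! hlt
      obtain rfl : t = y := by omega
      have : f (a t) (t + 1) ≤ f s (t + 1) := hf.monotone_fst _ ((ha t).2 s hfu.ge)
      omega
    · exact huy
    · omega
  refine hz ((cluster_eq_of_mem hy) ▸ htop _ fun t ht => ?_)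
  have hle : t.2 ≤ y := by simpa using hsub ht
  rcases hle.lt_or_eq with h | h
  · exact Or.inl h
  · refine Or.inr ⟨h, (ha y).2 _ ?_⟩
    rw [cluster_eq_of_mem hy] at ht
    rw [← hf.eq_of_mem_cluster ht, h]

/-- A 0-edge of the cluster from row `y` to row `y + 1` would stand at or east of `a y` and bound
the height at `(a y, y + 1)`. Without one, the cluster stays above row `y` and `(a (y + 1), y + 1)`
is its bottom left vertex. -/
theorem IsHeight.level_below (hf : IsHeight ω f)
    (ha : ∀ y, f (a y) y = f z.1 z.2 ∧ ∀ t, f z.1 z.2 ≤ f t y → a y ≤ t)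
    (hz : (cluster ω z).Infinite) (hbot : NoExtremalVertex BottomLeft ω)
    {y : ℤ} (hy : (a (y + 1), y + 1) ∈ cluster ω z) : f (a y) (y + 1) = f z.1 z.2 := by
  by_contra hne
  have hgt : f z.1 z.2 < f (a y) (y + 1) := by
    have : f (a y) y ≤ f (a y) (y + 1) := hf.monotone_snd _ (by omega)
    rw [(ha y).1] at this
    omega
  have hsub : cluster ω (a (y + 1), y + 1) ⊆ {w | y + 1 ≤ w.2} := by
    refine cluster_subset_of_adj_closed (by simp) fun u w hu huy huw => ?_
    rw [cluster_eq_of_mem hy] at hu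
    have hfu := hf.eq_of_mem_cluster hu
    have hfw := hf.eq_of_mem_cluster (mem_cluster_of_adj hu huw)
    obtain ⟨e, -, ⟨rfl, rfl⟩ | ⟨rfl, rfl⟩⟩ := zeroGraph_adj_iff.1 huw <;>
      rcases e with ⟨s, t⟩ | ⟨s, t⟩ <;>
      simp only [Edge.src, Edge.tgt, Set.mem_ofPred_eq] at *
    · exact huy
    · omega
    · exact huy
    · by_contra! hlt
      obtain rfl : t = y := by omega
      have : f (a t) (t + 1) ≤ f s (t + 1) := hf.monotone_fst _ ((ha t).2 s hfw.ge)
      omega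
  refine hz ((cluster_eq_of_mem hy) ▸ hbot _ fun t ht => ?_)
  have hle : y + 1 ≤ t.2 := by simpa using hsub ht
  rcases hle.lt_or_eq with h | h
  · exact Or.inl h
  · refine Or.inr ⟨h.symm, (ha (y + 1)).2 _ ?_⟩
    rw [cluster_eq_of_mem hy] at ht
    rw [← hf.eq_of_mem_cluster ht, h]

/-- For a cocycle with infinitely many labels `1` in both directions of every row and every column,
an infinite cluster has a directed path as its left boundary, provided that no infinite cluster has
a top left or a bottom left vertex. -/
theorem IsCocycle.leftBoundary_isPath (h : IsCocycle ω)
    (hrow : ∀ y, OnesBothSides fun x => ω (.horizontal x y))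
    (hcol : ∀ x, OnesBothSides fun y => ω (.vertical x y))
    (htop : NoExtremalVertex TopLeft ω) (hbot : NoExtremalVertex BottomLeft ω)
    (hz : (cluster ω z).Infinite) :
    (∀ n : ℤ, ∃ x : ℤ, IsLeftmostVertical ω (cluster ω z) n x) ∧
      ∃ p : ℤ → ℤ × ℤ, IsNWSEPath p ∧
        pathEdges p ⊆ clusterEdges ω (cluster ω z) ∧
        pathEdges p = leftBoundary ω (cluster ω z) := by
  obtain ⟨f, hf⟩ := h.exists_isHeight
  choose a ha using hf.exists_leftmost hrow (f z.1 z.2)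
  have hanti := hf.antitone_leftmost ha
  have row : ∀ {x x' y}, (x, y) ∈ cluster ω z → f x' y = f z.1 z.2 → (x', y) ∈ cluster ω z :=
    fun hx hx' => hf.mem_cluster_of_level hx ((hf.eq_of_mem_cluster hx).trans hx'.symm)
  have vert : ∀ {y}, f (a y) (y + 1) = f z.1 z.2 →
      (zeroGraph ω).Adj (a y, y) (a y, y + 1) := fun {y} hy =>
    adj_of_label_eq_zero (hf.label_vertical (x := a y) (y := y) (hy.trans (ha y).1.symm))
  have up : ∀ y, (a y, y) ∈ cluster ω z → (a (y + 1), y + 1) ∈ cluster ω z := fun y hy =>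
    row (mem_cluster_of_adj hy (vert (hf.level_above ha hz htop hy))) (ha (y + 1)).1
  have down : ∀ y, (a (y + 1), y + 1) ∈ cluster ω z → (a y, y) ∈ cluster ω z := fun y hy => by
    have hl := hf.level_below ha hz hbot hy
    exact mem_cluster_of_adj (row hy hl) (vert hl).symm
  have mem : ∀ y, (a y, y) ∈ cluster ω z := by
    have h0 : (a z.2, z.2) ∈ cluster ω z := row (x := z.1) (.refl _) (ha z.2).1
    intro y
    induction y using Int.inductionOn' (b := z.2) with
    | zero => exact h0
    | succ k _ ih => exact up k ih
    | pred k _ ih => exact down (k - 1) (by rwa [sub_add_cancel])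
  have hlev : ∀ y, f (a y) (y + 1) = f z.1 z.2 := fun y => hf.level_above ha hz htop (mem y)
  have hleft : ∀ n, IsLeftmostVertical ω (cluster ω z) n (a n) := fun n =>
    ⟨⟨hf.label_vertical ((hlev n).trans (ha n).1.symm), mem n,
      mem_cluster_of_adj (mem n) (vert (hlev n))⟩,
      fun t ht => (ha n).2 t (hf.eq_of_mem_cluster ht.2.1).ge⟩
  have hleft_iff : ∀ {n x}, IsLeftmostVertical ω (cluster ω z) n x ↔ x = a n := fun {n x} =>
    ⟨fun hx => hx.unique (hleft n), fun hx => hx ▸ hleft n⟩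
  have hbdry : leftBoundary ω (cluster ω z) = staircaseEdges a := by
    ext e
    refine or_congr ?_ ?_
    · simp [hleft_iff]
    · simp only [hleft_iff, Set.mem_ofPred_eq]
      refine ⟨?_, ?_⟩
      · rintro ⟨n, _, _, t, rfl, rfl, h1, h2, he⟩
        have : a (n + 1) ≤ a n := hanti (by omega)
        exact ⟨n, t, by omega, by omega, he⟩
      · rintro ⟨n, t, h1, h2, he⟩
        exact ⟨n, _, _, t, rfl, rfl, by omega, by omega, he⟩
  have hsub : staircaseEdges a ⊆ clusterEdges ω (cluster ω z) := by
    rintro e (⟨n, rfl⟩ | ⟨n, t, h1, h2, rfl⟩)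
    · exact (hleft n).1
    -- In row `n + 1` both `a (n + 1)` and `a n` have the cluster's height, so everything between
    -- them does.
    · have hl : ∀ s, a (n + 1) ≤ s → s ≤ a n → f s (n + 1) = f z.1 z.2 := by
        intro s hs hs'
        have e1 : f (a (n + 1)) (n + 1) ≤ f s (n + 1) := hf.monotone_fst _ hs
        have e2 : f s (n + 1) ≤ f (a n) (n + 1) := hf.monotone_fst _ hs'
        have e3 := (ha (n + 1)).1
        have e4 := hlev n
        omega
      have e1 := hl t h1 h2.le
      have e2 := hl (t + 1) (by omega) (by omega)
      exact ⟨hf.label_horizontal (e2.trans e1.symm), row (mem (n + 1)) e1, row (mem (n + 1)) e2⟩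
  obtain ⟨p, hp, hpe⟩ := Antitone.exists_staircase hanti
    -- Where column `b` has reached the cluster's height, `a n ≤ b`; where it is still lower, `b ≤ a
    -- n`.
    (fun b => by
      obtain ⟨n, hn⟩ := (hcol b).unbounded_above (fun y => (hf b y).2) (f z.1 z.2)
      exact ⟨n, (ha n).2 b hn⟩)
    (fun b => by
      obtain ⟨n, hn⟩ := (hcol b).unbounded_below (fun y => (hf b y).2) (f z.1 z.2)
      refine ⟨n, ?_⟩
      by_contra! hlt
      have : f (a n) n ≤ f b n := hf.monotone_fst n hlt.le
      rw [(ha n).1] at this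
      omega)
  exact ⟨fun n => ⟨a n, hleft n⟩, p, hp, hpe ▸ hsub, hpe.trans hbdry.symm⟩

end LeftBoundary

/-! ### Measurability of labels and clusters. -/

section Measurability

theorem measurableSet_exists {α ι : Type*} [MeasurableSpace α] [Countable ι] {p : ι → α → Prop}
    (h : ∀ i, MeasurableSet {x | p i x}) : MeasurableSet {x | ∃ i, p i x} := by
  convert MeasurableSet.iUnion h using 1
  ext x
  simp

theorem measurableSet_forall {α ι : Type*} [MeasurableSpace α] [Countable ι] {p : ι → α → Prop}
    (h : ∀ i, MeasurableSet {x | p i x}) : MeasurableSet {x | ∀ i, p i x} := by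
  convert MeasurableSet.iInter h using 1
  ext x
  simp

instance : Countable Edge :=
  Function.Injective.countable (f := fun e : Edge => (e.src, e.tgt)) fun e e' h => by
    rcases e with ⟨x, y⟩ | ⟨x, y⟩ <;> rcases e' with ⟨x', y'⟩ | ⟨x', y'⟩ <;>
      simp [Edge.src, Edge.tgt] at h ⊢ <;> omega

theorem measurable_label (e : Edge) : Measurable fun ω : Configuration => ω e :=
  measurable_pi_apply (X := fun _ : Edge => Fin 2) e

theorem measurableSet_label_eq (e : Edge) (i : Fin 2) :
    MeasurableSet {ω : Configuration | ω e = i} :=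
  measurable_label e (MeasurableSet.singleton i)

theorem measurableSet_adj (u w : ℤ × ℤ) :
    MeasurableSet {ω : Configuration | (zeroGraph ω).Adj u w} := by
  simp only [zeroGraph_adj_iff]
  exact measurableSet_exists fun e => (measurableSet_label_eq e 0).inter (.const _)

/-- Writes reachability through countably many steps, each measurable in the labelling. -/
theorem reachable_iff_exists_iterate {V : Type*} (G : SimpleGraph V) (u w : V) : G.Reachable u w ↔
    ∃ n : ℕ, w ∈ (fun S => {t | ∃ s ∈ S, G.Adj s t})^[n] {u} := by
  constructor
  · intro h
    induction (SimpleGraph.reachable_iff_reflTransGen _ _).1 h with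
    | refl => exact ⟨0, rfl⟩
    | tail hb hc ih =>
      obtain ⟨n, hn⟩ := ih ((SimpleGraph.reachable_iff_reflTransGen _ _).2 hb)
      exact ⟨n + 1, by rw [Function.iterate_succ_apply']; exact ⟨_, hn, hc⟩⟩
  · rintro ⟨n, hn⟩
    induction n generalizing w with
    | zero => rw [show w = u from hn]
    | succ n ih =>
      rw [Function.iterate_succ_apply'] at hn
      obtain ⟨s, hs, hst⟩ := hn
      exact (ih s hs).trans hst.reachable

theorem measurableSet_mem_cluster (u w : ℤ × ℤ) :
    MeasurableSet {ω : Configuration | w ∈ cluster ω u} := by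
  have key : ∀ (n : ℕ) (w : ℤ × ℤ), MeasurableSet {ω : Configuration |
      w ∈ (fun S => {t | ∃ s ∈ S, (zeroGraph ω).Adj s t})^[n] {u}} := by
    intro n
    induction n with
    | zero => exact fun w => .const _
    | succ n ih =>
      intro w
      simp only [Function.iterate_succ_apply']
      exact measurableSet_exists fun s => (ih s).inter (measurableSet_adj s w)
  have := MeasurableSet.iUnion fun n => key n w
  convert this using 1
  ext ω
  rw [Set.mem_iUnion]
  exact reachable_iff_exists_iterate _ _ _

instance : MeasurableConstVAdd (ℤ × ℤ) Configuration where
  measurable_const_vadd v := measurable_pi_lambda (X := fun _ : Edge => Fin 2) _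
    fun e => measurable_label (e.translate (-v))

end Measurability

/-! ### Translation covariance of clusters. -/

section Translations

theorem vadd_apply (v : ℤ × ℤ) (ω : Configuration) (e : Edge) :
    (v +ᵥ ω) e = ω (e.translate (-v)) := rfl

theorem vadd_adj {v u w : ℤ × ℤ} {ω : Configuration} (h : (zeroGraph ω).Adj u w) :
    (zeroGraph (v +ᵥ ω)).Adj (v + u) (v + w) := by
  obtain ⟨e, h0, h⟩ := zeroGraph_adj_iff.1 h
  refine zeroGraph_adj_iff.2 ⟨e.translate v, ?_, ?_⟩
  · rw [vadd_apply, ← h0]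
    cases e <;> simp [Edge.translate]
  · have hs : (e.translate v).src = v + e.src := by
      cases e <;> ext <;> simp [Edge.translate, Edge.src, add_comm]
    have ht : (e.translate v).tgt = v + e.tgt := by
      cases e <;> ext <;> simp [Edge.translate, Edge.tgt] <;> ring
    rw [hs, ht]
    simpa using h

theorem vadd_mem_cluster_vadd {v u w : ℤ × ℤ} {ω : Configuration} (h : w ∈ cluster ω u) :
    v + w ∈ cluster (v +ᵥ ω) (v + u) :=
  SimpleGraph.Reachable.map (⟨(v + ·), vadd_adj⟩ : zeroGraph ω →g zeroGraph (v +ᵥ ω)) h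

theorem mem_cluster_vadd_iff {v u w : ℤ × ℤ} {ω : Configuration} :
    w ∈ cluster (v +ᵥ ω) (v + u) ↔ -v + w ∈ cluster ω u := by
  constructor
  · intro h
    have := vadd_mem_cluster_vadd (v := -v) h
    rwa [neg_vadd_vadd, neg_add_cancel_left] at this
  · intro h
    have := vadd_mem_cluster_vadd (v := v) h
    rwa [add_neg_cancel_left] at this

end Translations

/-! ### Mass transport to extremal vertices. -/

section MassTransport

variable {μ : Measure Configuration} [VAddInvariantMeasure (ℤ × ℤ) Configuration μ]

/-- The event that `w` is the extremal vertex of the cluster of `u` for the relation `r`. -/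
def extremalEvent (r : ℤ × ℤ → ℤ × ℤ → Prop) (u w : ℤ × ℤ) : Set Configuration :=
  {ω | w ∈ cluster ω u ∧ ∀ t, t ∈ cluster ω u → r w t}

theorem measurableSet_extremalEvent (r : ℤ × ℤ → ℤ × ℤ → Prop) (u w : ℤ × ℤ) :
    MeasurableSet (extremalEvent r u w) :=
  (measurableSet_mem_cluster u w).inter <|
    measurableSet_forall fun t => (measurableSet_mem_cluster u t).imp (.const _)

theorem measure_extremalEvent_add {r : ℤ × ℤ → ℤ × ℤ → Prop}
    (hr : ∀ v u w, r (v + u) (v + w) ↔ r u w) (v u w : ℤ × ℤ) :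
    μ (extremalEvent r (v + u) (v + w)) = μ (extremalEvent r u w) := by
  rw [← (measurePreserving_vadd v μ).measure_preimage
    (measurableSet_extremalEvent r (v + u) (v + w)).nullMeasurableSet]
  congr 1
  ext ω
  refine and_congr (by rw [mem_cluster_vadd_iff, neg_add_cancel_left]) ?_
  refine ⟨fun h t ht => (hr v w t).1 (h _ (vadd_mem_cluster_vadd ht)), fun h t ht => ?_⟩
  have := (hr v _ _).2 (h _ (mem_cluster_vadd_iff.1 ht))
  rwa [add_neg_cancel_left] at this

/-- If every vertex sends unit mass to the extremal vertex of its cluster, then at most unit mass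
is sent on the average, so almost surely no vertex receives infinite mass. -/
theorem ae_noExtremalVertex [IsProbabilityMeasure μ] {r : ℤ × ℤ → ℤ × ℤ → Prop}
    (hr : ∀ v u w, r (v + u) (v + w) ↔ r u w) (hanti : ∀ u w, r u w → r w u → u = w) :
    ∀ᵐ ω ∂μ, NoExtremalVertex r ω := by
  refine ae_all_iff.2 fun w => ?_
  have hsum : ∑' u, μ (extremalEvent r u w) ≠ ⊤ := by
    -- Stationarity turns the mass received by `w` into the mass sent by `0`.
    have e : ∀ u, μ (extremalEvent r u w) = μ (extremalEvent r 0 (Equiv.subLeft w u)) := by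
      intro u
      rw [← measure_extremalEvent_add hr u 0]
      simp
    simp only [e]
    rw [(Equiv.subLeft w).tsum_eq fun t => μ (extremalEvent r 0 t)]
    refine ne_top_of_le_ne_top (measure_ne_top μ Set.univ) (tsum_measure_le_measure_univ
      (fun t => (measurableSet_extremalEvent r 0 t).nullMeasurableSet) fun t t' htt' => ?_)
    -- By antisymmetry of `r` a cluster has at most one extremal vertex, so the probabilities sum to
    -- at most 1.
    refine (Set.disjoint_left.2 fun ω h h' => htt' ?_).aedisjoint
    exact hanti _ _ (h.2 _ h'.1) (h'.2 _ h.1)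
  -- Borel–Cantelli: almost surely only finitely many `u` send their mass to `w`. If `w` is
  -- extremal, its whole cluster does.
  filter_upwards [ae_finite_setOfPred_mem hsum] with ω hω hw
  refine hω.subset fun u hu => ?_
  rw [← cluster_eq_of_mem hu] at hw
  exact ⟨SimpleGraph.Reachable.symm hu, hw⟩

end MassTransport

/-! ### Ones in all rows and columns. -/

section RowsAndColumns

/-- With `r = 0`, the sequence `v` is nondecreasing and `r'` is 1 exactly where `v` rises. A 0-1
sequence rises at most once, so `r'` has no second one. -/
theorem OnesBothSides.eq_zero_of_cocycle {r r' v : ℤ → Fin 2}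
    (h : ∀ n, (r n : ℕ) + (v (n + 1) : ℕ) = (v n : ℕ) + (r' n : ℕ)) (hr : ∀ n, r n = 0)
    (hr' : (∃ n, r' n ≠ 0) → OnesBothSides r') (n : ℤ) : r' n = 0 := by
  by_contra hn
  have hm : Monotone fun n => (v n : ℕ) := monotone_int_of_le_succ fun n => by
    have := h n
    rw [hr n, Fin.val_zero] at this
    omega
  obtain ⟨m, hm1, hm2⟩ := (hr' ⟨n, hn⟩ (n + 1)).1
  have h1 := h n
  have h2 := h m
  have h3 : (v (n + 1) : ℕ) ≤ v m := hm hm1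
  rw [fin_two_val_eq_one hn, hr, Fin.val_zero] at h1
  rw [fin_two_val_eq_one hm2, hr, Fin.val_zero] at h2
  have := (v (m + 1)).isLt
  omega

/-- Now `v` is nonincreasing, and `r` marks its at most one fall. -/
theorem OnesBothSides.eq_zero_of_cocycle' {r r' v : ℤ → Fin 2}
    (h : ∀ n, (r n : ℕ) + (v (n + 1) : ℕ) = (v n : ℕ) + (r' n : ℕ)) (hr' : ∀ n, r' n = 0)
    (hr : (∃ n, r n ≠ 0) → OnesBothSides r) (n : ℤ) : r n = 0 := by
  by_contra hn
  have hm : Antitone fun n => (v n : ℕ) := antitone_int_of_succ_le fun n => by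
    have := h n
    rw [hr' n, Fin.val_zero] at this
    omega
  obtain ⟨m, hm1, hm2⟩ := (hr ⟨n, hn⟩ (n + 1)).1
  have h1 := h n
  have h2 := h m
  have h3 : (v m : ℕ) ≤ v (n + 1) := hm hm1
  rw [fin_two_val_eq_one hn, hr', Fin.val_zero] at h1
  rw [fin_two_val_eq_one hm2, hr', Fin.val_zero] at h2
  have := (v n).isLt
  omega

/-- In a family of 0-1 sequences in which consecutive ones satisfy the cocycle relation, a single
vanishing sequence forces all sequences to vanish. -/
theorem OnesBothSides.forall_eq_zero {r v : ℤ → ℤ → Fin 2}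
    (h : ∀ k n, (r k n : ℕ) + (v k (n + 1) : ℕ) = (v k n : ℕ) + (r (k + 1) n : ℕ))
    (hr : ∀ k, (∃ n, r k n ≠ 0) → OnesBothSides (r k)) {k : ℤ} (hk : ∀ n, r k n = 0) (j n : ℤ) :
    r j n = 0 := by
  revert n
  induction j using Int.inductionOn' (b := k) with
  | zero => exact hk
  | succ j _ ih => exact eq_zero_of_cocycle (h j) ih (hr (j + 1))
  | pred j _ ih =>
    refine eq_zero_of_cocycle' (h (j - 1)) ?_ (hr (j - 1))
    rwa [sub_add_cancel]

variable {μ : Measure Configuration}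

theorem iterate_vadd (v : ℤ × ℤ) (n : ℕ) (ω : Configuration) :
    (v +ᵥ ·)^[n] ω = (n • v) +ᵥ ω := by
  induction n with
  | zero => simp
  | succ n ih => rw [Function.iterate_succ_apply', ih, vadd_vadd, succ_nsmul']

/-- Poincaré recurrence for the labels. -/
theorem ae_recurrence [IsProbabilityMeasure μ] [VAddInvariantMeasure (ℤ × ℤ) Configuration μ]
    (v : ℤ × ℤ) : ∀ᵐ ω ∂μ, ∀ e : Edge, ω e ≠ 0 →
      ∃ᶠ n : ℕ in atTop, ω (e.translate (-(n • v))) ≠ 0 := by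
  refine ae_all_iff.2 fun e => ?_
  have := (measurePreserving_vadd v μ).conservative.ae_mem_imp_frequently_image_mem
    (measurableSet_label_eq e 0).compl.nullMeasurableSet
  filter_upwards [this] with ω hω he
  exact (hω he).mono fun n hn => by rwa [iterate_vadd] at hn

theorem ae_rows_onesBothSides [IsProbabilityMeasure μ]
    [VAddInvariantMeasure (ℤ × ℤ) Configuration μ] :
    ∀ᵐ ω ∂μ, ∀ y, (∃ x, ω (.horizontal x y) ≠ 0) → OnesBothSides fun x => ω (.horizontal x y) := by
  -- Recurrence inspects the edge shifted by `-(n • v)`, so `(-1, 0)` yields ones to the right.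
  filter_upwards [ae_recurrence (μ := μ) (-1, 0), ae_recurrence (μ := μ) (1, 0)]
    with ω h1 h2 y ⟨x, hx⟩ N
  constructor
  · obtain ⟨n, hn, hn'⟩ := (frequently_atTop.1 (h1 _ hx)) (N - x).toNat
    exact ⟨x + n, by omega, by simpa [Edge.translate] using hn'⟩
  · obtain ⟨n, hn, hn'⟩ := (frequently_atTop.1 (h2 _ hx)) (x - N).toNat
    exact ⟨x - n, by omega, by simpa [Edge.translate, ← sub_eq_add_neg] using hn'⟩

theorem ae_columns_onesBothSides [IsProbabilityMeasure μ]
    [VAddInvariantMeasure (ℤ × ℤ) Configuration μ] :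
    ∀ᵐ ω ∂μ, ∀ x, (∃ y, ω (.vertical x y) ≠ 0) → OnesBothSides fun y => ω (.vertical x y) := by
  filter_upwards [ae_recurrence (μ := μ) (0, -1), ae_recurrence (μ := μ) (0, 1)]
    with ω h1 h2 x ⟨y, hy⟩ N
  constructor
  · obtain ⟨n, hn, hn'⟩ := (frequently_atTop.1 (h1 _ hy)) (N - y).toNat
    exact ⟨y + n, by omega, by simpa [Edge.translate] using hn'⟩
  · obtain ⟨n, hn, hn'⟩ := (frequently_atTop.1 (h2 _ hy)) (y - N).toNat
    exact ⟨y - n, by omega, by simpa [Edge.translate, ← sub_eq_add_neg] using hn'⟩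

/-- A translation invariant set of edges one of which has positive mean label almost surely contains
an edge with label `1`. -/
theorem ae_exists_label_ne_zero [ErgodicVAdd (ℤ × ℤ) Configuration μ] {S : Set Edge}
    (hS : ∀ v, ∀ e ∈ S, e.translate v ∈ S) {e : Edge} (he : e ∈ S) (hpos : 0 < meanLabel μ e) :
    ∀ᵐ ω ∂μ, ∃ e ∈ S, ω e ≠ 0 := by
  have hmeas : MeasurableSet {ω : Configuration | ∃ e ∈ S, ω e ≠ 0} :=
    measurableSet_exists fun e => (MeasurableSet.const _).inter (measurableSet_label_eq e 0).compl
  have hinv : ∀ v : ℤ × ℤ, (v +ᵥ ·) ⁻¹' {ω : Configuration | ∃ e ∈ S, ω e ≠ 0}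
      = {ω : Configuration | ∃ e ∈ S, ω e ≠ 0} := by
    intro v
    ext ω
    constructor
    · rintro ⟨e, he, h⟩
      exact ⟨_, hS (-v) e he, h⟩
    · rintro ⟨e, he, h⟩
      refine ⟨_, hS v e he, ?_⟩
      change ω ((e.translate v).translate (-v)) ≠ 0
      cases e <;> simpa [Edge.translate] using h
  rcases eventuallyConst_set.1 (aeconst_of_forall_preimage_vadd_ae_eq (μ := μ) (ℤ × ℤ)
    hmeas.nullMeasurableSet fun v => .of_eq (hinv v)) with h | h
  · exact h
  · refine absurd hpos (not_lt.2 (le_of_eq (integral_eq_zero_of_ae ?_)))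
    filter_upwards [h] with ω hω
    have : ω e = 0 := by
      by_contra h0
      exact hω ⟨e, he, h0⟩
    simp [this]

end RowsAndColumns

end CocyclePercolation

open CocyclePercolation

theorem lemma3p4 (μ : Measure Configuration) (hμ : IsStationaryErgodicCocycleMeasure μ)
    (hh : 0 < meanLabel μ (.horizontal 0 0) ∧ meanLabel μ (.horizontal 0 0) < 1)
    (hv : 0 < meanLabel μ (.vertical 0 0) ∧ meanLabel μ (.vertical 0 0) < 1) :
    ∀ᵐ ω ∂μ, ∀ z : ℤ × ℤ, (cluster ω z).Infinite →
      (∀ n : ℤ, ∃ x : ℤ, IsLeftmostVertical ω (cluster ω z) n x) ∧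
      ∃ p : ℤ → ℤ × ℤ, IsNWSEPath p ∧
        pathEdges p ⊆ clusterEdges ω (cluster ω z) ∧
        pathEdges p = leftBoundary ω (cluster ω z) := by
  have := hμ.isProbabilityMeasure
  have := hμ.ergodic
  have htop : ∀ᵐ ω ∂μ, NoExtremalVertex TopLeft ω := ae_noExtremalVertex
    (fun v u w => by simp [TopLeft])
    (fun u w h h' => by unfold TopLeft at h h'; ext <;> omega)
  have hbot : ∀ᵐ ω ∂μ, NoExtremalVertex BottomLeft ω := ae_noExtremalVertex
    (fun v u w => by simp [BottomLeft])
    (fun u w h h' => by unfold BottomLeft at h h'; ext <;> omega)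
  have hhor : ∀ᵐ ω ∂μ, ∃ e ∈ {e : Edge | ∃ x y, e = .horizontal x y}, ω e ≠ 0 :=
    ae_exists_label_ne_zero (by rintro v _ ⟨x, y, rfl⟩; exact ⟨_, _, rfl⟩) ⟨0, 0, rfl⟩ hh.1
  have hver : ∀ᵐ ω ∂μ, ∃ e ∈ {e : Edge | ∃ x y, e = .vertical x y}, ω e ≠ 0 :=
    ae_exists_label_ne_zero (by rintro v _ ⟨x, y, rfl⟩; exact ⟨_, _, rfl⟩) ⟨0, 0, rfl⟩ hv.1
  filter_upwards [hμ.ae_isCocycle, htop, hbot, hhor, hver, ae_rows_onesBothSides (μ := μ),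
    ae_columns_onesBothSides (μ := μ)] with ω hω ht hb ⟨_, ⟨x, y, rfl⟩, hxy⟩
      ⟨_, ⟨x', y', rfl⟩, hxy'⟩ hr hc z hz
  refine hω.leftBoundary_isPath (fun k => hr k ?_) (fun k => hc k ?_) ht hb hz
  · by_contra! h0
    exact hxy (OnesBothSides.forall_eq_zero (r := fun k n => ω (.horizontal n k))
      (v := fun k n => ω (.vertical n k)) (fun k n => hω n k) hr h0 y x)
  -- Swapping the coordinates exchanges the two sides of the cocycle relation, hence the `symm`
  -- below.
  · by_contra! h0
    exact hxy' (OnesBothSides.forall_eq_zero (r := fun k n => ω (.vertical k n))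
      (v := fun k n => ω (.horizontal k n)) (fun k n => (hω k n).symm) hc h0 x' y')
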